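/- A BL-algebra is an algebra $\langle A,\wedge,\vee,\cdot,\to,\bot,\top\rangle$ such that $\langle A,\wedge,\vee,\bot,\top\rangle$ is a bounded lattice, $\langle A,\cdot,\top\rangle$ is a commutative monoid, $a\cdot b\le c \iff a\le b\to c$, $a\wedge b=a\cdot(a\to b)$ and $(a\to b)\vee(b\to a)=\top$ for all $a,b,c$; a BL-chain is a totally ordered BL-algebra. A hoop is an algebra $\langle A,\cdot,\to,\top\rangle$ such that $\langle A,\cdot,\top\rangle$ is a commutative monoid, $x\to x=\top$, $x\cdot(x\to y)=y\cdot(y\to x)$ and $x\to(y\to z)=(x\cdot y)\to z$; it is ordered by $x\le y\iff x\to y=\top$, and it is a Wajsberg hoop if $(x\to y)\to y=(y\to x)\to x$. For a totally ordered set $I$ and hoops $\mathbf A_i$ ($i\in I$) with $A_i\cap A_j=\{\top\}$ for $i\ne j$ (up to isomorphism this may always be assumed), the ordinal sum $\bigoplus_{i\in I}\mathbf A_i$ is the hoop on $\bigcup_i A_i$ whose operations extend those of each $\mathbf A_i$ and satisfy $x\cdot y=y\cdot x=x$ and $x\to y=\top$ for $x\in A_i\setminus\{\top\}$, $y\in A_j$,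 $i<j$, and $x\to y=y$ for $y\in A_i$, $x\in A_j$, $i<j$. For a totally ordered hoop $\mathbf A$ with first element $\bot$, $\mathbf A^+$ is the BL-algebra obtained by adding the constant $\bot$ and the operations $x\wedge y=x\cdot(x\to y)$, $x\vee y=((x\to y)\to y)\wedge((y\to x)\to x)$. Every nontrivial BL-chain $\mathbf A$ can be written as $\mathbf A=(\bigoplus_{i\in I}\mathbf A_i)^+$, where $I$ is a total order with first element $0$, every $\mathbf A_i$ is a nontrivial totally ordered Wajsberg hoop, and $\mathbf A_0$ has first element $\bot^{\mathbf A}$; let $I_b$ be the set of those $i\in I$ for which $\mathbf A_i$ has a first element. Let $\mathbf S_1$ be the two-element hoop $\{\bot,\top\}$ (with $\cdot$ the minimum), and let $\mathbf S_1^\omega$ be the hoop with universe $\{(0,k):k\in\mathbb N\}\cup\{(1,-k):k\in\mathbb N\}$, ordered lexicographically, with $\top=(1,0)$ and \[(0,j)\cdot(0,k)=(0,0),\quad (1,-j)\cdot(1,-k)=(1,-(j+k)),\quad (0,j)\cdot(1,-k)=(1,-k)\cdot(0,j)=(0,\max\{j-k,0\}),\] \[a\to b=\top \text{ if } a\le b,\quad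 (0,j)\to(0,k)=(1,k-j)\ (j>k),\quad (1,-j)\to(0,k)=(0,j+k),\quad (1,-j)\to(1,-k)=(1,j-k)\ (j<k).\] A variety of BL-algebras is the class of all BL-algebras satisfying some set of identities. Such a variety $\mathcal V$ has property (T) if there are a BL-chain $\mathbf A\in\mathcal V$ with a decomposition $\mathbf A=(\bigoplus_{i\in I}\mathbf A_i)^+$ as above, an index $i\in I_b\setminus\{0\}$ and an element $a\in A_i$ such that $a^{n+1}<a^n$ for all $n\ge 0$ (where $a^0=\top$). **Proposition.** A variety $\mathcal V$ of BL-algebras has property (T) if and only if $(\mathbf S_1\oplus\mathbf S_1^\omega)^+\in\mathcal V$. -/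

import Mathlib

universe u v

/-! ### BL-algebras, terms and varieties -/

/-- A BL-algebra: a bounded lattice with a commutative monoid structure whose unit is `⊤`, a
residuum `⇨` of the multiplication, satisfying divisibility and prelinearity. -/
class BLAlgebra (A : Type u) extends Lattice A, BoundedOrder A, CommMonoid A, HImp A where
  one_eq_top : (1 : A) = ⊤
  residuation : ∀ a b c : A, a * b ≤ c ↔ a ≤ b ⇨ c
  divisibility : ∀ a b : A, a ⊓ b = a * (a ⇨ b)
  prelinearity : ∀ a b : A, (a ⇨ b) ⊔ (b ⇨ a) = ⊤

/-- A BL-chain is a totally ordered BL-algebra. -/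
def IsBLChain (A : Type u) [BLAlgebra A] : Prop := ∀ a b : A, a ≤ b ∨ b ≤ a

/-- Terms in the language `{∧, ∨, ·, →, ⊥, ⊤}` over countably many variables. -/
inductive BLTerm : Type
  | var (n : ℕ) : BLTerm
  | bot : BLTerm
  | top : BLTerm
  | inf (s t : BLTerm) : BLTerm
  | sup (s t : BLTerm) : BLTerm
  | mul (s t : BLTerm) : BLTerm
  | imp (s t : BLTerm) : BLTerm

/-- The value of a term in a BL-algebra under an assignment of the variables. -/
def BLTerm.eval {A : Type u} [BLAlgebra A] (e : ℕ → A) : BLTerm → A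
  | .var n => e n
  | .bot => ⊥
  | .top => ⊤
  | .inf s t => s.eval e ⊓ t.eval e
  | .sup s t => s.eval e ⊔ t.eval e
  | .mul s t => s.eval e * t.eval e
  | .imp s t => s.eval e ⇨ t.eval e

/-- A variety of BL-algebras, presented by the identities `s ≈ t` that define it inside the class
of all BL-algebras. -/
structure BLVariety where
  identities : Set (BLTerm × BLTerm)

/-- The BL-algebra `A` belongs to the variety `V`. -/
def BLVariety.Mem (V : BLVariety) (A : Type u) [BLAlgebra A] : Prop :=
  ∀ p ∈ V.identities, ∀ e : ℕ → A, p.1.eval e = p.2.eval e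

/-! ### Hoops -/

/-- A hoop. The unit `1` of the monoid is the last element, which is also written `⊤`. -/
class Hoop (A : Type u) extends CommMonoid A, HImp A where
  himp_self' : ∀ a : A, a ⇨ a = 1
  mul_himp' : ∀ a b : A, a * (a ⇨ b) = b * (b ⇨ a)
  himp_himp' : ∀ a b c : A, a ⇨ (b ⇨ c) = (a * b) ⇨ c

namespace Hoop

/-- The order of a hoop. -/
def Le {A : Type u} [Hoop A] (a b : A) : Prop := a ⇨ b = 1

/-- The hoop is totally ordered. -/
def IsTotallyOrdered (A : Type u) [Hoop A] : Prop := ∀ a b : A, Le a b ∨ Le b a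

/-- The hoop is a Wajsberg hoop. -/
def IsWajsberg (A : Type u) [Hoop A] : Prop := ∀ a b : A, (a ⇨ b) ⇨ b = (b ⇨ a) ⇨ a

/-- `b` is the first element of the hoop. -/
def IsFirst {A : Type u} [Hoop A] (b : A) : Prop := ∀ a : A, Le b a

section Basic

variable {A : Type u} [Hoop A]

theorem Le.eq_one {a b : A} (h : Le a b) : a ⇨ b = 1 := h

theorem le_antisymm {a b : A} (h : Le a b) (h' : Le b a) : a = b := by
  have := mul_himp' a b
  rw [show a ⇨ b = 1 from h, show b ⇨ a = 1 from h'] at this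
  simpa using this

theorem one_himp (a : A) : 1 ⇨ a = a := by
  apply le_antisymm
  · have h := himp_himp' (1 ⇨ a) 1 a
    rw [himp_self', mul_one] at h
    exact h.symm
  · have h := himp_himp' a 1 a
    rwa [mul_one, himp_self'] at h

theorem himp_one (a : A) : a ⇨ 1 = 1 := by
  have h : a * (a ⇨ 1) = a := by
    have := mul_himp' a 1
    rwa [one_mul, one_himp] at this
  have h' := himp_himp' (a ⇨ 1) a 1
  rw [himp_self', mul_comm, h] at h'
  exact h'.symm

theorem le_himp_iff {a b c : A} : Le a (b ⇨ c) ↔ Le (a * b) c := by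
  unfold Le
  rw [himp_himp']

theorem le_trans {a b c : A} (h : Le a b) (h' : Le b c) : Le a c := by
  have e : a = b * (b ⇨ a) := by
    have := mul_himp' a b
    rwa [show a ⇨ b = 1 from h, mul_one] at this
  unfold Le
  rw [e, mul_comm, ← himp_himp', show b ⇨ c = 1 from h', himp_one]

theorem mul_le_left (a b : A) : Le (a * b) a := by
  unfold Le
  rw [mul_comm, ← himp_himp', himp_self', himp_one]

theorem eq_one_of_mul {a b : A} (h : a * b = 1) : a = 1 := by
  have := mul_le_left a b
  rw [h] at this
  exact le_antisymm (himp_one a) this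

theorem le_refl (a : A) : Le a a := himp_self' a

theorem mul_himp_le (a b : A) : Le (a * (a ⇨ b)) b := by
  rw [mul_himp']
  exact mul_le_left _ _

end Basic

/-- The bounded hoop `A⁺` of a totally ordered hoop `A` with first element `b`, seen as a
BL-algebra: `x ∧ y = x · (x → y)` and `x ∨ y = ((x → y) → y) ∧ ((y → x) → x)`. -/
abbrev plus (A : Type u) [Hoop A] (tot : IsTotallyOrdered A) (b : A) (hb : IsFirst b) :
    BLAlgebra A where
  le := Le
  le_refl := le_refl
  le_trans _ _ _ := le_trans
  le_antisymm _ _ := le_antisymm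
  inf x y := x * (x ⇨ y)
  inf_le_left x y := mul_le_left _ _
  inf_le_right x y := mul_himp_le _ _
  le_inf x y z h h' := by
    have e : x = y * (y ⇨ x) := by
      have := mul_himp' x y
      rwa [show x ⇨ y = 1 from h, mul_one] at this
    have k : Le (y ⇨ x) (y ⇨ z) := by
      rw [le_himp_iff, mul_comm, ← e]
      exact h'
    change Le x (y * (y ⇨ z))
    have k' : Le (y ⇨ x) (y ⇨ (y * (y ⇨ z))) := by
      refine le_trans k ?_
      rw [le_himp_iff, mul_comm]
      exact le_refl _
    rw [le_himp_iff, mul_comm, ← e] at k'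
    exact k'
  sup x y := ((x ⇨ y) ⇨ y) * (((x ⇨ y) ⇨ y) ⇨ ((y ⇨ x) ⇨ x))
  le_sup_left x y := by
    have h1 : Le x ((x ⇨ y) ⇨ y) := le_himp_iff.2 (mul_himp_le x y)
    have h2 : Le x ((y ⇨ x) ⇨ x) := le_himp_iff.2 (mul_le_left x _)
    rcases tot ((x ⇨ y) ⇨ y) ((y ⇨ x) ⇨ x) with h | h
    · rw [h.eq_one, mul_one]
      assumption
    · rw [mul_himp', h.eq_one, mul_one]
      assumption
  le_sup_right x y := by
    have h1 : Le y ((x ⇨ y) ⇨ y) := le_himp_iff.2 (mul_le_left y _)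
    have h2 : Le y ((y ⇨ x) ⇨ x) := le_himp_iff.2 (mul_himp_le y x)
    rcases tot ((x ⇨ y) ⇨ y) ((y ⇨ x) ⇨ x) with h | h
    · rw [h.eq_one, mul_one]
      assumption
    · rw [mul_himp', h.eq_one, mul_one]
      assumption
  sup_le x y z hx hy := by
    rcases tot x y with h | h
    · refine le_trans (mul_le_left _ _) ?_
      rw [show x ⇨ y = 1 from h, one_himp]
      exact hy
    · refine le_trans (mul_himp_le _ _) ?_
      rw [show y ⇨ x = 1 from h, one_himp]
      exact hx
  top := 1
  le_top := himp_one
  bot := b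
  bot_le := hb
  one_eq_top := rfl
  residuation a b c := le_himp_iff.symm
  divisibility _ _ := rfl
  prelinearity x y := by
    change ((_ ⇨ _) ⇨ _) * _ = (1 : A)
    rcases tot x y with h | h <;>
      simp [h.eq_one, himp_one, one_himp, himp_self']

end Hoop

/-! ### Ordinal sums -/

/-- The universe of the ordinal sum of the hoops `H i`: the disjoint union of the sets
`H i \ {⊤}` together with one common last element `⊤`. -/
inductive OrdinalSum {I : Type v} (H : I → Type u) [∀ i, Hoop (H i)] : Type (max u v)
  | top : OrdinalSum H
  | mk (i : I) (x : H i) (hx : x ≠ 1) : OrdinalSum H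

namespace OrdinalSum

section

variable {I : Type v} {H : I → Type u} [∀ i, Hoop (H i)]

open Classical in
/-- The inclusion of the component `H i` in the ordinal sum. -/
noncomputable def of (i : I) (x : H i) : OrdinalSum H :=
  if hx : x = 1 then top else mk i x hx

theorem of_one (i : I) : (of i (1 : H i) : OrdinalSum H) = top := by simp [of]

theorem of_ne {i : I} {x : H i} (hx : x ≠ 1) : (of i x : OrdinalSum H) = mk i x hx := by
  simp [of, hx]

instance : One (OrdinalSum H) := ⟨top⟩

theorem of_eq_one (i : I) : (of i (1 : H i) : OrdinalSum H) = 1 := of_one i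

theorem top_eq : (top : OrdinalSum H) = 1 := rfl

theorem ind {p : OrdinalSum H → Prop} (h1 : p 1) (h : ∀ i (x : H i), x ≠ 1 → p (of i x))
    (x : OrdinalSum H) : p x := by
  cases x with
  | top => exact h1
  | mk i x hx => rw [← of_ne hx]; exact h i x hx

theorem mul_ne {i : I} {x y : H i} (hx : x ≠ 1) : x * y ≠ 1 :=
  fun h => hx (Hoop.eq_one_of_mul h)

variable [LinearOrder I]

/-- The product of the ordinal sum: computed inside a component when both elements lie in it, and
otherwise the factor of lower index. -/
noncomputable def mul : OrdinalSum H → OrdinalSum H → OrdinalSum H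
  | top, y => y
  | mk i x hx, top => mk i x hx
  | mk i x hx, mk j y hy =>
    if h : i = j then of j ((h ▸ x) * y) else if i < j then mk i x hx else mk j y hy

/-- The implication of the ordinal sum. -/
noncomputable def imp : OrdinalSum H → OrdinalSum H → OrdinalSum H
  | top, y => y
  | mk _ _ _, top => top
  | mk i x _, mk j y hy =>
    if h : i = j then of j ((h ▸ x) ⇨ y) else if i < j then top else mk j y hy

noncomputable instance : Mul (OrdinalSum H) := ⟨mul⟩
noncomputable instance : HImp (OrdinalSum H) := ⟨imp⟩

theorem one_mul' (x : OrdinalSum H) : 1 * x = x := by cases x <;> rfl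

theorem mul_one' (x : OrdinalSum H) : x * 1 = x := by cases x <;> rfl

theorem one_imp (x : OrdinalSum H) : 1 ⇨ x = x := by cases x <;> rfl

theorem imp_one (x : OrdinalSum H) : x ⇨ 1 = 1 := by cases x <;> rfl

theorem of_mul_of (i : I) (x y : H i) :
    (of i x * of i y : OrdinalSum H) = of i (x * y) := by
  by_cases hx : x = 1
  · subst hx
    rw [of_eq_one, one_mul', one_mul]
  by_cases hy : y = 1
  · subst hy
    rw [of_eq_one, mul_one', mul_one]
  rw [of_ne hx, of_ne hy]
  change mul _ _ = _
  simp [mul]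

theorem of_mul_of_lt {i j : I} (h : i < j) {x : H i} (hx : x ≠ 1) (y : H j) :
    (of i x * of j y : OrdinalSum H) = of i x := by
  by_cases hy : y = 1
  · subst hy
    rw [of_eq_one, mul_one']
  rw [of_ne hx, of_ne hy]
  change mul _ _ = _
  simp [mul, h, h.ne]

theorem of_mul_of_gt {i j : I} (h : i < j) {x : H i} (hx : x ≠ 1) (y : H j) :
    (of j y * of i x : OrdinalSum H) = of i x := by
  by_cases hy : y = 1
  · subst hy
    rw [of_eq_one, one_mul']
  rw [of_ne hx, of_ne hy]
  change mul _ _ = _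
  simp [mul, h.ne', h.le]

theorem of_imp_of (i : I) (x y : H i) :
    (of i x ⇨ of i y : OrdinalSum H) = of i (x ⇨ y) := by
  by_cases hx : x = 1
  · subst hx
    rw [of_eq_one, one_imp, Hoop.one_himp]
  by_cases hy : y = 1
  · subst hy
    rw [of_eq_one, imp_one, Hoop.himp_one, of_eq_one]
  rw [of_ne hx, of_ne hy]
  change imp _ _ = _
  simp [imp]

theorem of_imp_of_lt {i j : I} (h : i < j) {x : H i} (hx : x ≠ 1) (y : H j) :
    (of i x ⇨ of j y : OrdinalSum H) = 1 := by
  by_cases hy : y = 1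
  · subst hy
    rw [of_eq_one, imp_one]
  rw [of_ne hx, of_ne hy]
  change imp _ _ = _
  simp [imp, h, h.ne, top_eq]

theorem of_imp_of_gt {i j : I} (h : i < j) (x : H i) (y : H j) :
    (of j y ⇨ of i x : OrdinalSum H) = of i x := by
  by_cases hx : x = 1
  · subst hx
    rw [of_eq_one, imp_one]
  by_cases hy : y = 1
  · subst hy
    rw [of_eq_one, one_imp]
  rw [of_ne hx, of_ne hy]
  change imp _ _ = _
  simp [imp, h.ne', h.le]

theorem mul_comm' (x y : OrdinalSum H) : x * y = y * x := by
  induction x using ind with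
  | h1 => rw [one_mul', mul_one']
  | h i x hx =>
    induction y using ind with
    | h1 => rw [one_mul', mul_one']
    | h j y hy =>
      rcases lt_trichotomy i j with h | rfl | h
      · rw [of_mul_of_lt h hx, of_mul_of_gt h hx]
      · rw [of_mul_of, of_mul_of, mul_comm]
      · rw [of_mul_of_lt h hy, of_mul_of_gt h hy]

theorem mul_assoc' (x y z : OrdinalSum H) : x * y * z = x * (y * z) := by
  induction x using ind with
  | h1 => rw [one_mul', one_mul']
  | h i x hx =>
    induction y using ind with
    | h1 => rw [one_mul', mul_one']
    | h j y hy =>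
      induction z using ind with
      | h1 => rw [mul_one', mul_one']
      | h k z hz =>
        rcases lt_trichotomy j k with h' | rfl | h' <;>
        rcases lt_trichotomy i j with h | rfl | h
        · rw [of_mul_of_lt h hx, of_mul_of_lt h' hy, of_mul_of_lt h hx,
            of_mul_of_lt (h.trans h') hx]
        · rw [of_mul_of, of_mul_of_lt h' hy, of_mul_of_lt h' (mul_ne hx), of_mul_of]
        · rw [of_mul_of_gt h hy, of_mul_of_lt h' hy, of_mul_of_gt h hy]
        · rw [of_mul_of_lt h hx, of_mul_of, of_mul_of_lt h hx, of_mul_of_lt h hx]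
        · rw [of_mul_of, of_mul_of, of_mul_of, of_mul_of, mul_assoc]
        · rw [of_mul_of_gt h hy, of_mul_of, of_mul_of_gt h (mul_ne hy)]
        · rw [of_mul_of_lt h hx, of_mul_of_gt h' hz]
        · rw [of_mul_of, of_mul_of_gt h' hz, of_mul_of_gt h' hz, of_mul_of_gt h' hz]
        · rw [of_mul_of_gt h hy, of_mul_of_gt h' hz, of_mul_of_gt (h'.trans h) hz]

theorem imp_self (x : OrdinalSum H) : x ⇨ x = 1 := by
  induction x using ind with
  | h1 => rw [one_imp]
  | h i x hx => rw [of_imp_of, Hoop.himp_self', of_eq_one]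

theorem mul_imp (x y : OrdinalSum H) : x * (x ⇨ y) = y * (y ⇨ x) := by
  induction x using ind with
  | h1 => rw [one_imp, one_mul', imp_one, mul_one']
  | h i x hx =>
    induction y using ind with
    | h1 => rw [one_imp, one_mul', imp_one, mul_one']
    | h j y hy =>
      rcases lt_trichotomy i j with h | rfl | h
      · rw [of_imp_of_lt h hx, of_imp_of_gt h, mul_one', of_mul_of_gt h hx]
      · rw [of_imp_of, of_imp_of, of_mul_of, of_mul_of, Hoop.mul_himp']
      · rw [of_imp_of_lt h hy, of_imp_of_gt h, mul_one', of_mul_of_gt h hy]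

theorem imp_imp (x y z : OrdinalSum H) : x ⇨ (y ⇨ z) = (x * y) ⇨ z := by
  induction x using ind with
  | h1 => rw [one_imp, one_mul']
  | h i x hx =>
    induction y using ind with
    | h1 => rw [one_imp, mul_one']
    | h j y hy =>
      induction z using ind with
      | h1 => rw [imp_one, imp_one, imp_one]
      | h k z hz =>
        rcases lt_trichotomy j k with h' | rfl | h' <;>
        rcases lt_trichotomy i j with h | rfl | h
        · rw [of_mul_of_lt h hx, of_imp_of_lt h' hy, imp_one, of_imp_of_lt (h.trans h') hx]
        · rw [of_mul_of, of_imp_of_lt h' hy, imp_one, of_imp_of_lt h' (mul_ne hx)]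
        · rw [of_mul_of_gt h hy, of_imp_of_lt h' hy, imp_one]
        · rw [of_mul_of_lt h hx, of_imp_of, of_imp_of_lt h hx, of_imp_of_lt h hx]
        · rw [of_mul_of, of_imp_of, of_imp_of, of_imp_of, Hoop.himp_himp']
        · rw [of_mul_of_gt h hy, of_imp_of, of_imp_of_gt h]
        · rw [of_mul_of_lt h hx, of_imp_of_gt h']
        · rw [of_mul_of, of_imp_of_gt h', of_imp_of_gt h', of_imp_of_gt h']
        · rw [of_mul_of_gt h hy, of_imp_of_gt h', of_imp_of_gt (h'.trans h)]

noncomputable instance : Hoop (OrdinalSum H) where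
  mul_assoc := mul_assoc'
  one_mul := one_mul'
  mul_one := mul_one'
  mul_comm := mul_comm'
  himp_self' := imp_self
  mul_himp' := mul_imp
  himp_himp' := imp_imp

theorem isTotallyOrdered (h : ∀ i, Hoop.IsTotallyOrdered (H i)) :
    Hoop.IsTotallyOrdered (OrdinalSum H) := by
  intro x y
  induction x using ind with
  | h1 => exact Or.inr (imp_one y)
  | h i x hx =>
    induction y using ind with
    | h1 => exact Or.inl (imp_one _)
    | h j y hy =>
      rcases lt_trichotomy i j with hij | rfl | hij
      · exact Or.inl (of_imp_of_lt hij hx y)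
      · rcases h i x y with k | k
        · exact Or.inl ((of_imp_of i x y).trans ((congrArg _ k).trans (of_eq_one i)))
        · exact Or.inr ((of_imp_of i y x).trans ((congrArg _ k).trans (of_eq_one i)))
      · exact Or.inr (of_imp_of_lt hij hy x)

theorem isFirst_of [OrderBot I] {b : H ⊥} (hb : Hoop.IsFirst b) (hb1 : b ≠ 1) :
    Hoop.IsFirst (of ⊥ b : OrdinalSum H) := by
  intro y
  induction y using ind with
  | h1 => exact imp_one _
  | h j y hy =>
    rcases eq_or_lt_of_le (bot_le : ⊥ ≤ j) with rfl | h
    · exact (of_imp_of _ b y).trans ((congrArg _ (hb y)).trans (of_eq_one _))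
    · exact of_imp_of_lt h hb1 y

end

end OrdinalSum

/-- The family with the two members `A` (index `false`) and `B` (index `true`). -/
def PairFamily (A B : Type u) : Bool → Type u
  | false => A
  | true => B

instance PairFamily.instHoop (A B : Type u) [Hoop A] [Hoop B] :
    ∀ i, Hoop (PairFamily A B i)
  | false => inferInstanceAs (Hoop A)
  | true => inferInstanceAs (Hoop B)

/-! ### The hoops `S_n` and `S_1^ω` -/

/-- The universe `{a^0, …, a^n}` of `S_n`; the element `a^i` is stored as its exponent `i`. -/
@[ext]
structure SFin (n : ℕ) where
  exp : ℕ
  exp_le : exp ≤ n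

/-- The hoop `S_n`: `a^i · a^j = a^(min (i + j) n)` and `a^i → a^j = a^(max (j - i) 0)`. -/
instance SFin.instHoop (n : ℕ) : Hoop (SFin n) where
  mul x y := ⟨min (x.exp + y.exp) n, min_le_right _ _⟩
  one := ⟨0, Nat.zero_le _⟩
  himp x y := ⟨y.exp - x.exp, (Nat.sub_le _ _).trans y.exp_le⟩
  mul_assoc x y z := SFin.ext (by
    change min (min (x.exp + y.exp) n + z.exp) n = min (x.exp + min (y.exp + z.exp) n) n
    omega)
  one_mul x := SFin.ext (by
    have := x.exp_le
    change min (0 + x.exp) n = x.exp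
    omega)
  mul_one x := SFin.ext (by
    have := x.exp_le
    change min (x.exp + 0) n = x.exp
    omega)
  mul_comm x y := SFin.ext (by
    change min (x.exp + y.exp) n = min (y.exp + x.exp) n
    omega)
  himp_self' x := SFin.ext (Nat.sub_self x.exp)
  mul_himp' x y := SFin.ext (by
    change min (x.exp + (y.exp - x.exp)) n = min (y.exp + (x.exp - y.exp)) n
    omega)
  himp_himp' x y z := SFin.ext (by
    have := z.exp_le
    change z.exp - y.exp - x.exp = z.exp - min (x.exp + y.exp) n
    omega)

theorem SFin.isTotallyOrdered (n : ℕ) : Hoop.IsTotallyOrdered (SFin n) := by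
  intro x y
  rcases Nat.le_total x.exp y.exp with h | h
  · exact Or.inr (SFin.ext (Nat.sub_eq_zero_of_le h))
  · exact Or.inl (SFin.ext (Nat.sub_eq_zero_of_le h))

theorem SFin.isFirst (n : ℕ) : Hoop.IsFirst (⟨n, le_refl n⟩ : SFin n) := fun x =>
  SFin.ext (Nat.sub_eq_zero_of_le x.exp_le)

/-- The universe of `S_1^ω`: `lo k` is the pair `(0, k)` and `hi k` is the pair `(1, -k)`, ordered
lexicographically. -/
inductive SOneOmega : Type
  | lo (k : ℕ) : SOneOmega
  | hi (k : ℕ) : SOneOmega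

/-- The product of `S_1^ω` (with truncated subtraction). -/
def SOneOmega.mul : SOneOmega → SOneOmega → SOneOmega
  | lo _, lo _ => lo 0
  | hi j, hi k => hi (j + k)
  | lo j, hi k => lo (j - k)
  | hi k, lo j => lo (j - k)

/-- The implication of `S_1^ω` (with truncated subtraction). -/
def SOneOmega.imp : SOneOmega → SOneOmega → SOneOmega
  | lo j, lo k => hi (j - k)
  | lo _, hi _ => hi 0
  | hi j, lo k => lo (j + k)
  | hi j, hi k => hi (k - j)

/-- The hoop `S_1^ω`. -/
instance SOneOmega.instHoop : Hoop SOneOmega where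
  mul := SOneOmega.mul
  one := .hi 0
  himp := SOneOmega.imp
  mul_assoc x y z := by
    change mul (mul x y) z = mul x (mul y z)
    cases x <;> cases y <;> cases z <;> simp only [mul, lo.injEq, hi.injEq] <;> omega
  one_mul x := by
    change mul (.hi 0) x = x
    cases x <;> simp [mul]
  mul_one x := by
    change mul x (.hi 0) = x
    cases x <;> simp [mul]
  mul_comm x y := by
    change mul x y = mul y x
    cases x <;> cases y <;> simp only [mul, hi.injEq]
    omega
  himp_self' x := by
    change imp x x = .hi 0
    cases x <;> simp [imp]
  mul_himp' x y := by
    change mul x (imp x y) = mul y (imp y x)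
    cases x <;> cases y <;> simp only [mul, imp, lo.injEq, hi.injEq] <;> omega
  himp_himp' x y z := by
    change imp x (imp y z) = imp (mul x y) z
    cases x <;> cases y <;> cases z <;> simp only [mul, imp, lo.injEq, hi.injEq] <;> omega

theorem SOneOmega.isTotallyOrdered : Hoop.IsTotallyOrdered SOneOmega := by
  intro x y
  change imp x y = .hi 0 ∨ imp y x = .hi 0
  cases x <;> cases y <;> simp only [imp, hi.injEq, reduceCtorEq, or_true, true_or] <;> omega

/-! ### The BL-chain `(S_1 ⊕ S_1^ω)⁺` -/

/-- The universe of `(S_1 ⊕ S_1^ω)⁺`. -/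
abbrev SOneOneOmega : Type := OrdinalSum (PairFamily (SFin 1) SOneOmega)

theorem SOneOneOmega.isTotallyOrdered : Hoop.IsTotallyOrdered SOneOneOmega :=
  OrdinalSum.isTotallyOrdered fun
    | false => SFin.isTotallyOrdered 1
    | true => SOneOmega.isTotallyOrdered

/-- The first element of `S_1 ⊕ S_1^ω`, which is the first element `a^1` of `S_1`. -/
noncomputable def SOneOneOmega.first : SOneOneOmega :=
  OrdinalSum.of (H := PairFamily (SFin 1) SOneOmega) ⊥ (⟨1, le_refl 1⟩ : SFin 1)

theorem SOneOneOmega.isFirst_first : Hoop.IsFirst SOneOneOmega.first :=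
  OrdinalSum.isFirst_of (H := PairFamily (SFin 1) SOneOmega) (SFin.isFirst 1)
    (fun h => one_ne_zero (congrArg SFin.exp h))

/-- The BL-chain `(S_1 ⊕ S_1^ω)⁺`. -/
noncomputable instance SOneOneOmega.instBLAlgebra : BLAlgebra SOneOneOmega :=
  Hoop.plus SOneOneOmega SOneOneOmega.isTotallyOrdered SOneOneOmega.first
    SOneOneOmega.isFirst_first

/-! ### Decompositions of BL-chains and property (T) -/

/-- A decomposition `A = (⨁_{i ∈ I} A_i)⁺` of the BL-chain `A` as an ordinal sum of nontrivial
totally ordered Wajsberg hoops over a total order `I` with first element, whose first component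
has a first element, namely the first element of `A`. -/
structure OrdinalDecomposition (A : Type u) [BLAlgebra A] where
  I : Type u
  [linearOrder : LinearOrder I]
  [orderBot : OrderBot I]
  comp : I → Type u
  [hoop : ∀ i, Hoop (comp i)]
  nontrivial : ∀ i, Nontrivial (comp i)
  totallyOrdered : ∀ i, Hoop.IsTotallyOrdered (comp i)
  wajsberg : ∀ i, Hoop.IsWajsberg (comp i)
  equiv : A ≃* OrdinalSum comp
  equiv_himp : ∀ a b : A, equiv (a ⇨ b) = equiv a ⇨ equiv b
  equiv_bot : ∃ b : comp ⊥, Hoop.IsFirst b ∧ equiv ⊥ = OrdinalSum.of ⊥ b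

attribute [instance] OrdinalDecomposition.linearOrder OrdinalDecomposition.orderBot
  OrdinalDecomposition.hoop

/-- The component `A_i`, as a subset of `A`. -/
def OrdinalDecomposition.component {A : Type u} [BLAlgebra A] (D : OrdinalDecomposition A)
    (i : D.I) : Set A :=
  {a | ∃ x : D.comp i, D.equiv a = OrdinalSum.of i x}

/-- The index set `I_b` of the components that have a first element. -/
def OrdinalDecomposition.boundedIndices {A : Type u} [BLAlgebra A]
    (D : OrdinalDecomposition A) : Set D.I :=
  {i | ∃ b : D.comp i, Hoop.IsFirst b}

/-- Property (T): some BL-chain in `V` has, in a bounded component other than the first one, an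
element whose powers are strictly decreasing. -/
def BLVariety.PropertyT (V : BLVariety) : Prop :=
  ∃ (A : Type u) (_ : BLAlgebra A), IsBLChain A ∧ V.Mem A ∧
    ∃ (D : OrdinalDecomposition A), ∃ i ∈ D.boundedIndices \ {⊥}, ∃ a ∈ D.component i,
      ∀ n : ℕ, a ^ (n + 1) < a ^ n

/-! ### Homomorphisms of hoops and identities -/

/-! Identities pass to subalgebras, so from (T) it is enough to embed `(S_1 ⊕ S_1^ω)⁺` in the
BL-chain `A` that witnesses it. Let `b` be the first element of the bounded component `A_i`, `i ≠
0`. As `A_i` is a Wajsberg hoop, the complement `x ↦ x → b` is an involution. The powers of `a`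
never stabilise, so none of them is `b`, and by totality every complement `a^j → b` lies below every
power `a^k`. This forces the powers and their complements to compute exactly like the pairs `(1,
-k)` and `(0, k)`: they form a copy of `S_1^ω` inside `A_i` (`SOneOmega.isEmbedding_lift`). The
elements `⊥` and `⊤` form a copy of `S_1` inside `A_0` (`SFin.isEmbedding_lift`). Since `0 < i`, the
two copies together form the ordinal sum (`OrdinalSum.isEmbedding_map`), and it contains the bottom
of `A`, so `BLVariety.Mem.of_injective` applies.

Conversely, `(S_1 ⊕ S_1^ω)⁺` itself witnesses (T), with the element `(1, -1)` of its second
component. -/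

/-- A map of hoops preserving the operations, under which only `1` is sent to `1`. -/
structure Hoop.IsEmbedding {A : Type*} {B : Type*} [Hoop A] [Hoop B] (f : A → B) : Prop where
  map_mul : ∀ x y, f (x * y) = f x * f y
  map_himp : ∀ x y, f (x ⇨ y) = f x ⇨ f y
  eq_one : ∀ x, f x = 1 → x = 1

namespace Hoop.IsEmbedding

variable {A : Type*} {B : Type*} [Hoop A] [Hoop B] {f : A → B}

theorem map_one (hf : IsEmbedding f) : f 1 = 1 := by
  rw [← Hoop.himp_self' (1 : A), hf.map_himp, Hoop.himp_self']

/-- If `f x = f y`, both `x ⇨ y` and `y ⇨ x` are sent to `1`, hence are `1`, and antisymmetry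
applies. -/
theorem injective (hf : IsEmbedding f) : Function.Injective f := fun x y h =>
  Hoop.le_antisymm (hf.eq_one _ (by rw [hf.map_himp, h, Hoop.himp_self']))
    (hf.eq_one _ (by rw [hf.map_himp, h, Hoop.himp_self']))

end Hoop.IsEmbedding

theorem BLAlgebra.le_iff_himp_eq_top {A : Type*} [BLAlgebra A] (a b : A) :
    a ≤ b ↔ a ⇨ b = ⊤ := by
  rw [← top_le_iff, ← BLAlgebra.residuation, ← BLAlgebra.one_eq_top, one_mul]

theorem BLAlgebra.himp_self {A : Type*} [BLAlgebra A] (a : A) : a ⇨ a = ⊤ :=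
  (BLAlgebra.le_iff_himp_eq_top a a).1 le_rfl

/-- Identities pass from a BL-algebra to every BL-chain that embeds in it. -/
theorem BLVariety.Mem.of_injective {V : BLVariety} {A : Type*} {B : Type*} [BLAlgebra A]
    [BLAlgebra B] (hB : V.Mem B) (hA : IsBLChain A) (f : A → B) (inj : Function.Injective f)
    (map_mul : ∀ x y, f (x * y) = f x * f y) (map_himp : ∀ x y, f (x ⇨ y) = f x ⇨ f y)
    (map_bot : f ⊥ = ⊥) : V.Mem A := by
  have map_top : f ⊤ = ⊤ := by
    rw [← BLAlgebra.himp_self (⊤ : A), map_himp, BLAlgebra.himp_self]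
  have mono : ∀ x y, x ≤ y → f x ≤ f y := fun x y h => by
    rw [BLAlgebra.le_iff_himp_eq_top] at h ⊢
    rw [← map_himp, h, map_top]
  have map_eval : ∀ (e : ℕ → A) (t : BLTerm), f (t.eval e) = t.eval (f ∘ e) := by
    intro e t
    induction t with
    | var n => rfl
    | bot => exact map_bot
    | top => exact map_top
    -- By divisibility the meet is a term in the product and the implication.
    | inf s t hs ht =>
      simp only [BLTerm.eval, ← hs, ← ht, BLAlgebra.divisibility, map_mul, map_himp]
    -- In a chain the join is the larger argument, so monotonicity of `f` is enough.
    | sup s t hs ht =>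
      simp only [BLTerm.eval, ← hs, ← ht]
      rcases hA (s.eval e) (t.eval e) with h | h
      · rw [sup_eq_right.2 h, sup_eq_right.2 (mono _ _ h)]
      · rw [sup_eq_left.2 h, sup_eq_left.2 (mono _ _ h)]
    | mul s t hs ht => simp only [BLTerm.eval, ← hs, ← ht, map_mul]
    | imp s t hs ht => simp only [BLTerm.eval, ← hs, ← ht, map_himp]
  intro p hp e
  apply inj
  rw [map_eval, map_eval]
  exact hB p hp _

/-! ### Maps of ordinal sums -/

namespace OrdinalSum

variable {I J : Type*} {H : I → Type*} {K : J → Type*} [∀ i, Hoop (H i)] [∀ j, Hoop (K j)]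

/-- The map of ordinal sums induced by a map of the index sets and maps of the components. -/
noncomputable def map (g : I → J) (f : ∀ i, H i → K (g i)) : OrdinalSum H → OrdinalSum K
  | top => top
  | mk i x _ => of (g i) (f i x)

theorem of_eq_one_iff {i : I} {x : H i} : (of i x : OrdinalSum H) = 1 ↔ x = 1 := by
  refine ⟨fun h => ?_, fun h => h ▸ of_eq_one i⟩
  by_contra hx
  rw [of_ne hx] at h
  cases h

theorem of_injective (i : I) : Function.Injective (of i : H i → OrdinalSum H) := by
  intro x y h
  by_cases hx : x = 1
  · rw [hx, of_eq_one] at h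
    rw [hx, of_eq_one_iff.1 h.symm]
  by_cases hy : y = 1
  · rw [hy, of_eq_one] at h
    exact absurd (of_eq_one_iff.1 h) hx
  rw [of_ne hx, of_ne hy] at h
  simpa using h

variable {g : I → J} {f : ∀ i, H i → K (g i)}

theorem map_one : map g f 1 = 1 := rfl

theorem map_of (hf : ∀ i, Hoop.IsEmbedding (f i)) (i : I) (x : H i) :
    map g f (of i x) = of (g i) (f i x) := by
  by_cases hx : x = 1
  · rw [hx, of_eq_one, (hf i).map_one, of_eq_one, map_one]
  · rw [of_ne hx, map]

variable [LinearOrder I] [LinearOrder J]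

theorem of_pow (i : I) (x : H i) (n : ℕ) : (of i (x ^ n) : OrdinalSum H) = of i x ^ n := by
  induction n with
  | zero => rw [pow_zero, pow_zero, of_eq_one]
  | succ n ih => rw [pow_succ, pow_succ, ← of_mul_of, ih]

/-- Strict monotonicity of `g` keeps the relative position of two components. Elements other than
`1` keep images other than `1`, so the rules for distinct components still apply to the images. -/
theorem isEmbedding_map (hg : StrictMono g) (hf : ∀ i, Hoop.IsEmbedding (f i)) :
    Hoop.IsEmbedding (map g f) where
  map_mul x y := by
    have ne : ∀ i (x : H i), x ≠ 1 → f i x ≠ 1 := fun i x => mt ((hf i).eq_one x)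
    induction x using ind with
    | h1 => rw [map_one, one_mul, one_mul]
    | h i x hx =>
      induction y using ind with
      | h1 => rw [map_one, mul_one, mul_one]
      | h j y hy =>
        rcases lt_trichotomy i j with h | rfl | h
        · rw [of_mul_of_lt h hx, map_of hf, map_of hf, of_mul_of_lt (hg h) (ne _ _ hx)]
        · rw [of_mul_of, map_of hf, map_of hf, map_of hf, of_mul_of, (hf i).map_mul]
        · rw [of_mul_of_gt h hy, map_of hf, map_of hf, of_mul_of_gt (hg h) (ne _ _ hy)]
  map_himp x y := by
    have ne : ∀ i (x : H i), x ≠ 1 → f i x ≠ 1 := fun i x => mt ((hf i).eq_one x)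
    induction x using ind with
    | h1 => rw [map_one, one_imp, one_imp]
    | h i x hx =>
      induction y using ind with
      | h1 => rw [map_one, imp_one, imp_one, map_one]
      | h j y hy =>
        rcases lt_trichotomy i j with h | rfl | h
        · rw [of_imp_of_lt h hx, map_of hf, map_of hf, of_imp_of_lt (hg h) (ne _ _ hx), map_one]
        · rw [of_imp_of, map_of hf, map_of hf, map_of hf, of_imp_of, (hf i).map_himp]
        · rw [of_imp_of_gt h, map_of hf, map_of hf, of_imp_of_gt (hg h)]
  eq_one x := by
    induction x using ind with
    | h1 => exact fun _ => rfl
    | h i x hx =>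
      rw [map_of hf, of_eq_one_iff]
      exact fun h => absurd ((hf i).eq_one x h) hx

end OrdinalSum

/-! ### Embeddings of `S_1` and `S_1^ω` -/

/-- The map from `S_1` that sends the first element to `b`. -/
def SFin.lift {A : Type*} [One A] (b : A) (x : SFin 1) : A := if x.exp = 0 then 1 else b

/-- The first element is idempotent, so it forms a two-element subhoop together with `1`. -/
theorem SFin.isEmbedding_lift {A : Type*} [Hoop A] {b : A} (hb : Hoop.IsFirst b) (hb1 : b ≠ 1) :
    Hoop.IsEmbedding (SFin.lift b) where
  map_mul := by
    have bb : b * b = b := Hoop.le_antisymm (Hoop.mul_le_left _ _) (hb _)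
    rintro ⟨m, hm⟩ ⟨n, hn⟩
    change (if min (m + n) 1 = 0 then (1 : A) else b) = (if m = 0 then 1 else b) *
      if n = 0 then 1 else b
    interval_cases m <;> interval_cases n <;> simp [bb]
  map_himp := by
    rintro ⟨m, hm⟩ ⟨n, hn⟩
    change (if n - m = 0 then (1 : A) else b) = (if m = 0 then 1 else b) ⇨
      if n = 0 then 1 else b
    interval_cases m <;> interval_cases n <;>
      simp [Hoop.himp_one, Hoop.one_himp, Hoop.himp_self']
  eq_one x h := by
    by_cases hx : x.exp = 0
    · exact SFin.ext hx
    · rw [SFin.lift, if_neg hx] at h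
      exact absurd h hb1

/-- The map from `S_1^ω` that sends `(1, -k)` to `a ^ k` and `(0, k)` to the complement of `a ^ k`
with respect to `b`. -/
def SOneOmega.lift {A : Type*} [Hoop A] (a b : A) : SOneOmega → A
  | lo k => a ^ k ⇨ b
  | hi k => a ^ k

section

variable {A : Type*} [Hoop A]

/-- The Wajsberg identity turns the double complement into `(b ⇨ x) ⇨ x`, where `b ⇨ x = 1`. -/
theorem Hoop.himp_himp_of_isFirst (wajs : Hoop.IsWajsberg A) {b : A} (hb : Hoop.IsFirst b)
    (x : A) : (x ⇨ b) ⇨ b = x := by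
  rw [wajs, (hb x).eq_one, Hoop.one_himp]

theorem Hoop.mul_eq_of_isFirst {b : A} (hb : Hoop.IsFirst b) (x : A) : b * x = b :=
  Hoop.le_antisymm (Hoop.mul_le_left _ _) (hb _)

/-- The first element absorbs products, so powers that reach it stay there. -/
theorem Hoop.pow_ne_of_isFirst {a b : A} (hb : Hoop.IsFirst b)
    (ha : ∀ n : ℕ, a ^ (n + 1) ≠ a ^ n) (n : ℕ) : a ^ n ≠ b := by
  intro h
  apply ha n
  rw [pow_succ, h, Hoop.mul_eq_of_isFirst hb]

theorem SOneOmega.isEmbedding_lift (tot : Hoop.IsTotallyOrdered A) (wajs : Hoop.IsWajsberg A)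
    {a b : A} (hb : Hoop.IsFirst b) (ha : ∀ n : ℕ, a ^ (n + 1) ≠ a ^ n) :
    Hoop.IsEmbedding (SOneOmega.lift a b) := by
  -- Otherwise `a ^ k` lies below the complement of `a ^ j`, which makes `a ^ (k + j)` the first
  -- element.
  have le_pow : ∀ j k : ℕ, Hoop.Le (a ^ j ⇨ b) (a ^ k) := by
    intro j k
    refine (tot _ _).resolve_right fun h => ?_
    rw [Hoop.le_himp_iff, ← pow_add] at h
    exact Hoop.pow_ne_of_isFirst hb ha _ (Hoop.le_antisymm h (hb _))
  have compl_mul : ∀ x : A, x * (x ⇨ b) = b := fun x =>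
    Hoop.le_antisymm (Hoop.mul_himp_le _ _) (hb _)
  -- For `j = k + m` the left side is `a ^ k * (a ^ k ⇨ (a ^ m ⇨ b))`, the meet of `a ^ k` and `a ^
  -- m ⇨ b`, which is the latter by `le_pow`. For `j ≤ k` the factor `a ^ j` already brings the
  -- product down to `b`, the complement of `a ^ 0`.
  have lo_mul : ∀ j k : ℕ, (a ^ j ⇨ b) * a ^ k = a ^ (j - k) ⇨ b := by
    intro j k
    rcases le_total k j with h | h
    · obtain ⟨m, rfl⟩ := Nat.exists_eq_add_of_le h
      rw [Nat.add_sub_cancel_left, pow_add, ← Hoop.himp_himp', mul_comm, Hoop.mul_himp',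
        (le_pow m k).eq_one, mul_one]
    · obtain ⟨m, rfl⟩ := Nat.exists_eq_add_of_le h
      rw [Nat.sub_eq_zero_of_le h, pow_zero, Hoop.one_himp, pow_add, ← mul_assoc,
        mul_comm _ (a ^ j), compl_mul, Hoop.mul_eq_of_isFirst hb]
  refine ⟨?_, ?_, ?_⟩
  · rintro (j | j) (k | k)
    · change a ^ 0 ⇨ b = (a ^ j ⇨ b) * (a ^ k ⇨ b)
      -- Being below `a ^ k`, the first factor is a multiple of `a ^ k`, which the second factor
      -- sends to `b`.
      have e : a ^ j ⇨ b = a ^ k * (a ^ k ⇨ (a ^ j ⇨ b)) := by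
        rw [Hoop.mul_himp', (le_pow j k).eq_one, mul_one]
      rw [pow_zero, Hoop.one_himp, e, mul_right_comm, compl_mul, Hoop.mul_eq_of_isFirst hb]
    · exact (lo_mul j k).symm
    · exact (lo_mul k j).symm.trans (mul_comm _ _)
    · exact pow_add a j k
  · rintro (j | j) (k | k)
    · change a ^ (j - k) = (a ^ j ⇨ b) ⇨ (a ^ k ⇨ b)
      rw [Hoop.himp_himp', lo_mul, Hoop.himp_himp_of_isFirst wajs hb]
    · exact (pow_zero a).trans (le_pow j k).eq_one.symm
    · change a ^ (j + k) ⇨ b = a ^ j ⇨ (a ^ k ⇨ b)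
      rw [Hoop.himp_himp', pow_add]
    · change a ^ (k - j) = a ^ j ⇨ a ^ k
      -- Writing `a ^ k` as a double complement reduces the implication to the complement of a
      -- product covered by `lo_mul`.
      rw [← Hoop.himp_himp_of_isFirst wajs hb (a ^ k), Hoop.himp_himp', mul_comm, lo_mul,
        Hoop.himp_himp_of_isFirst wajs hb]
  · rintro (k | k) h
    · exact absurd (Hoop.le_antisymm h (hb _)) (Hoop.pow_ne_of_isFirst hb ha k)
    · cases k with
      | zero => rfl
      | succ k =>
        change a ^ (k + 1) = 1 at h
        rw [pow_succ'] at h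
        exact absurd (by simpa using Hoop.eq_one_of_mul h) (ha 0)

end

/-! ### The hoops `S_n` and `S_1^ω` as components -/

theorem SOneOmega.isWajsberg : Hoop.IsWajsberg SOneOmega := by
  intro x y
  change imp (imp x y) y = imp (imp y x) x
  cases x <;> cases y <;> simp only [imp, lo.injEq, hi.injEq] <;> omega

theorem SOneOmega.isFirst_lo_zero : Hoop.IsFirst (lo 0) := by
  intro x
  change imp (lo 0) x = hi 0
  cases x <;> simp [imp]

theorem SOneOmega.hi_one_pow (n : ℕ) : hi 1 ^ n = hi n := by
  induction n with
  | zero => rfl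
  | succ n ih => rw [pow_succ, ih]; rfl

theorem SFin.isWajsberg (n : ℕ) : Hoop.IsWajsberg (SFin n) := by
  rintro ⟨x, hx⟩ ⟨y, hy⟩
  refine SFin.ext ?_
  change y - (y - x) = x - (x - y)
  omega

theorem SOneOneOmega.isBLChain : IsBLChain SOneOneOmega := SOneOneOmega.isTotallyOrdered

/-! ### Property (T) -/

theorem BLVariety.PropertyT.mem {V : BLVariety} (h : BLVariety.PropertyT.{u} V) :
    V.Mem SOneOneOmega := by
  obtain ⟨A, _, -, hV, D, i, ⟨⟨b, hb⟩, hi⟩, a, ⟨x, hx⟩, ha⟩ := h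
  obtain ⟨b₀, hb₀, hbot⟩ := D.equiv_bot
  -- If the first element were `1`, the component would be trivial.
  have hb₀1 : b₀ ≠ 1 := by
    rintro rfl
    have := D.nontrivial ⊥
    obtain ⟨y, hy⟩ := exists_ne (1 : D.comp ⊥)
    exact hy (Hoop.le_antisymm (Hoop.himp_one y) (hb₀ y))
  have hx' : ∀ n : ℕ, x ^ (n + 1) ≠ x ^ n := by
    intro n e
    have e' := congrArg (OrdinalSum.of (H := D.comp) i) e
    rw [OrdinalSum.of_pow, OrdinalSum.of_pow, ← hx, ← map_pow, ← map_pow] at e'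
    exact (ha n).ne (D.equiv.injective e')
  let g : Bool → D.I := fun c => bif c then i else ⊥
  let f : ∀ c, PairFamily (SFin 1) SOneOmega c → D.comp (g c)
    | false => SFin.lift b₀
    | true => SOneOmega.lift x b
  -- This is where the exclusion of the first index is used.
  have hg : StrictMono g := by
    have : (⊥ : D.I) < i := bot_lt_iff_ne_bot.2 hi
    rintro (_ | _) (_ | _) hcd
    · exact absurd hcd (lt_irrefl _)
    · exact this
    · exact absurd hcd (by decide)
    · exact absurd hcd (lt_irrefl _)
  have hf : ∀ c, Hoop.IsEmbedding (f c)
    | false => SFin.isEmbedding_lift hb₀ hb₀1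
    | true => SOneOmega.isEmbedding_lift (D.totallyOrdered i) (D.wajsberg i) hb hx'
  have hm := OrdinalSum.isEmbedding_map hg hf
  refine hV.of_injective SOneOneOmega.isBLChain (fun y => D.equiv.symm (OrdinalSum.map g f y))
    (D.equiv.symm.injective.comp hm.injective) (fun y z => ?_) (fun y z => ?_) ?_
  · rw [← map_mul]
    exact congrArg D.equiv.symm (hm.map_mul y z)
  · apply D.equiv.injective
    rw [D.equiv_himp]
    simp only [MulEquiv.apply_symm_apply]
    exact hm.map_himp y z
  -- The bottom of `SOneOneOmega` is the element of exponent `1` in `S_1`, which `SFin.lift b₀`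
  -- sends to `b₀`.
  · rw [MulEquiv.symm_apply_eq, hbot]
    exact OrdinalSum.map_of hf false (⟨1, le_refl 1⟩ : SFin 1)

/-! ### A copy of the chain in an arbitrary universe -/

instance ULift.instHoop {A : Type*} [Hoop A] : Hoop (ULift A) where
  himp x y := ⟨x.down ⇨ y.down⟩
  himp_self' x := congrArg ULift.up (Hoop.himp_self' x.down)
  mul_himp' x y := congrArg ULift.up (Hoop.mul_himp' x.down y.down)
  himp_himp' x y z := congrArg ULift.up (Hoop.himp_himp' x.down y.down z.down)

/-- Property (T) asks for a chain and components in a given universe, whereas `S_1 ⊕ S_1^ω` lives in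
`Type`. This embedding carries the identities of `SOneOneOmega` over to the lifted sum. -/
theorem ULift.isEmbedding_down {A : Type*} [Hoop A] :
    Hoop.IsEmbedding (ULift.down : ULift A → A) where
  map_mul _ _ := rfl
  map_himp _ _ := rfl
  eq_one _ h := ULift.down_injective h

/-- The components of `S_1 ⊕ S_1^ω`, lifted to an arbitrary universe. -/
abbrev LiftedFamily (i : ULift.{u} Bool) : Type u :=
  ULift.{u} (PairFamily (SFin 1) SOneOmega i.down)

theorem LiftedFamily.nontrivial (i : ULift.{u} Bool) : Nontrivial (LiftedFamily i) := by
  obtain ⟨_ | _⟩ := i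
  · exact ⟨⟨(⟨0, zero_le⟩ : SFin 1)⟩, ⟨(⟨1, le_rfl⟩ : SFin 1)⟩,
      fun h => zero_ne_one (congrArg SFin.exp (ULift.up_injective h))⟩
  · exact ⟨⟨SOneOmega.hi 0⟩, ⟨SOneOmega.lo 0⟩,
      fun h => SOneOmega.noConfusion (ULift.up_injective h)⟩

theorem LiftedFamily.isTotallyOrdered (i : ULift.{u} Bool) :
    Hoop.IsTotallyOrdered (LiftedFamily i) := by
  intro x y
  have : Hoop.IsTotallyOrdered (PairFamily (SFin 1) SOneOmega i.down) := by
    obtain ⟨_ | _⟩ := i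
    · exact SFin.isTotallyOrdered 1
    · exact SOneOmega.isTotallyOrdered
  exact (this x.down y.down).imp (congrArg ULift.up) (congrArg ULift.up)

theorem LiftedFamily.isWajsberg (i : ULift.{u} Bool) : Hoop.IsWajsberg (LiftedFamily i) := by
  intro x y
  have : Hoop.IsWajsberg (PairFamily (SFin 1) SOneOmega i.down) := by
    obtain ⟨_ | _⟩ := i
    · exact SFin.isWajsberg 1
    · exact SOneOmega.isWajsberg
  exact congrArg ULift.up (this x.down y.down)

theorem BLVariety.propertyT_of_mem {V : BLVariety} (hV : V.Mem SOneOneOmega) :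
    BLVariety.PropertyT.{u} V := by
  have tot := OrdinalSum.isTotallyOrdered LiftedFamily.isTotallyOrdered.{u}
  let b : LiftedFamily.{u} ⊥ := ⟨(⟨1, le_refl 1⟩ : SFin 1)⟩
  have hb : Hoop.IsFirst b := fun x => congrArg ULift.up (SFin.isFirst 1 x.down)
  have hb1 : b ≠ 1 := fun h => one_ne_zero (congrArg SFin.exp (ULift.up_injective h))
  have hfirst := OrdinalSum.isFirst_of (H := LiftedFamily.{u}) hb hb1
  let inst : BLAlgebra (OrdinalSum LiftedFamily.{u}) := Hoop.plus _ tot _ hfirst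
  have chain : IsBLChain (OrdinalSum LiftedFamily.{u}) := tot
  let f : ∀ i, LiftedFamily.{u} i → PairFamily (SFin 1) SOneOmega i.down := fun _ => ULift.down
  have hf : ∀ i, Hoop.IsEmbedding (f i) := fun _ => ULift.isEmbedding_down
  have hm := OrdinalSum.isEmbedding_map (g := ULift.down.{u}) (fun _ _ h => h) hf
  -- The algebra is an ordinal sum by construction, so the identity map decomposes it. The second
  -- component has first element `(0, 0)`, and `a` is `(1, -1)`, whose powers are the `(1, -n)`.
  refine ⟨OrdinalSum LiftedFamily.{u}, inst, chain,
    hV.of_injective chain _ hm.injective hm.map_mul hm.map_himp (OrdinalSum.map_of hf _ _),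
    { I := ULift.{u} Bool
      comp := LiftedFamily
      nontrivial := LiftedFamily.nontrivial
      totallyOrdered := LiftedFamily.isTotallyOrdered
      wajsberg := LiftedFamily.isWajsberg
      equiv := MulEquiv.refl _
      equiv_himp := fun _ _ => rfl
      equiv_bot := ⟨b, hb, rfl⟩ }, ⟨true⟩, ⟨⟨⟨SOneOmega.lo 0⟩, fun x => ?_⟩, ?_⟩,
    OrdinalSum.of (⟨true⟩ : ULift.{u} Bool) ⟨SOneOmega.hi 1⟩, ⟨_, rfl⟩, fun n => ?_⟩
  · exact congrArg ULift.up (SOneOmega.isFirst_lo_zero x.down)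
  · exact fun h => Bool.noConfusion (ULift.up_injective h)
  -- Powers decrease weakly in every hoop. Strictness follows from distinctness of the powers, which
  -- is read off inside `S_1^ω`.
  · refine lt_of_le_of_ne ?_ fun h => ?_
    · rw [pow_succ]
      exact Hoop.mul_le_left _ _
    · have h' := OrdinalSum.of_injective (H := LiftedFamily.{u}) ⟨true⟩
        ((OrdinalSum.of_pow _ _ (n + 1)).trans (h.trans (OrdinalSum.of_pow _ _ n).symm))
      have h'' : SOneOmega.hi 1 ^ (n + 1) = SOneOmega.hi 1 ^ n := congrArg ULift.down h'
      rw [SOneOmega.hi_one_pow, SOneOmega.hi_one_pow] at h''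
      exact absurd (SOneOmega.hi.inj h'') (Nat.succ_ne_self n)

theorem mainTheorem6 (V : BLVariety) : BLVariety.PropertyT.{u} V ↔ V.Mem SOneOneOmega :=
  ⟨BLVariety.PropertyT.mem, BLVariety.propertyT_of_mem⟩
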